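/- Let $p,\tilde p:[0,1]\to\mathbb R$ be piecewise continuous (continuous at all but finitely many points, with finite one-sided limits everywhere) and bounded below by a positive constant. Let $\alpha\in(0,\pi]$, $\beta\in[0,\pi)$, and assume that $\cos\alpha\cos\beta-\sin(\alpha-\beta)\neq 0$ whenever $(\alpha,\beta)\in[\pi/4,\pi]\times[0,3\pi/4]$. Let $\lambda_0$ be the lowest eigenvalue of the problem $$-u''=\lambda\, p(x)\,u\ \text{ on }(0,1),\qquad u(0)\cos\alpha+u'(0)\sin\alpha=0,\qquad u(1)\cos\beta+u'(1)\sin\beta=0,$$ where solutions are $C^1$ on $[0,1]$ and satisfy the equation at all but finitely many points, and let $\tilde\lambda_0$ be the lowest eigenvalue of the same problem with $\tilde p$ in place of $p$. If $$\lambda_0=\tilde\lambda_0\,\sup_{x\in[0,1]}\frac{\tilde p(x)}{p(x)}\qquad\text{or}\qquad \lambda_0=\tilde\lambda_0\,\inf_{x\in[0,1]}\frac{\tilde p(x)}{p(x)}$$ (in particular if this holds with a maximum or minimum that is attained), then $$p(x)=\frac{\tilde\lambda_0}{\lambda_0}\,\tilde p(x)$$ for all but finitely many $x\in[0,1]$,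 and more precisely at every $x\in[0,1]$ at which $p$ and $\tilde p$ are both right-continuous (with $x<1$) or both left-continuous (with $x>0$). In particular the equality holds on all of $[0,1]$ if $p$ and $\tilde p$ are continuous. -/

import Mathlib

open Set Filter Topology

namespace VibratingString

/-- Piecewise continuity on `[0,1]`: continuous at all but finitely many points of `[0,1]`,
with finite one-sided limits at every point of `[0,1]` (from inside the interval). -/
def PiecewiseContinuous (p : ℝ → ℝ) : Prop :=
  (∃ F : Finset ℝ, ∀ x ∈ Icc (0 : ℝ) 1, x ∉ F → ContinuousWithinAt p (Icc 0 1) x) ∧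
  (∀ x ∈ Ico (0 : ℝ) 1, ∃ l : ℝ, Tendsto p (𝓝[>] x) (𝓝 l)) ∧
  (∀ x ∈ Ioc (0 : ℝ) 1, ∃ l : ℝ, Tendsto p (𝓝[<] x) (𝓝 l))

/-- Density of a string on `[0,1]`: piecewise continuous, positive and bounded away from `0`. -/
structure IsDensity (p : ℝ → ℝ) : Prop where
  piecewiseContinuous : PiecewiseContinuous p
  boundedAway : ∃ c : ℝ, 0 < c ∧ ∀ x ∈ Icc (0 : ℝ) 1, c ≤ p x

/-- `u` solves `-u'' = z p u` on `(0,1)` and `v = u'`: `u` is continuously differentiable on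
`[0,1]` (one-sided derivatives at the end points), and the equation holds at all but finitely
many points, as `u''` need not exist at the jumps of `p`. -/
structure IsSolution (p : ℝ → ℝ) (z : ℂ) (u v : ℝ → ℂ) : Prop where
  hasDeriv : ∀ x ∈ Icc (0 : ℝ) 1, HasDerivWithinAt u (v x) (Icc 0 1) x
  continuousOn_deriv : ContinuousOn v (Icc 0 1)
  equation : ∃ F : Finset ℝ, ∀ x ∈ Ioo (0 : ℝ) 1, x ∉ F →
    ∃ w : ℂ, HasDerivAt v w x ∧ -w = z * (p x : ℂ) * u x

/-- `z` is an eigenvalue of the string problem `-u'' = z p u` with boundary conditions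
`u(0) cos α + u'(0) sin α = 0` and `u(1) cos β + u'(1) sin β = 0`. -/
def IsEigenvalue (p : ℝ → ℝ) (α β : ℝ) (z : ℂ) : Prop :=
  ∃ u v : ℝ → ℂ, IsSolution p z u v ∧
    u 0 * (Real.cos α : ℂ) + v 0 * (Real.sin α : ℂ) = 0 ∧
    u 1 * (Real.cos β : ℂ) + v 1 * (Real.sin β : ℂ) = 0 ∧
    ∃ x ∈ Icc (0 : ℝ) 1, u x ≠ 0

/-- `l` is the lowest eigenvalue (all eigenvalues of the problem are real). -/
def IsLowestEigenvalue (p : ℝ → ℝ) (α β l : ℝ) : Prop :=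
  IsLeast {t : ℝ | IsEigenvalue p α β (t : ℂ)} l

/-- The two functions on `[0,1]` are both right-continuous at `x < 1`, or both left-continuous
at `x > 0`. -/
def ContinuousFromCommonSide (p q : ℝ → ℝ) (x : ℝ) : Prop :=
  (x < 1 ∧ ContinuousWithinAt p (Icc x 1) x ∧ ContinuousWithinAt q (Icc x 1) x) ∨
  (0 < x ∧ ContinuousWithinAt p (Icc 0 x) x ∧ ContinuousWithinAt q (Icc 0 x) x)

end VibratingString

/-!
Let `u` be a lowest eigenfunction for `(p, l)` and `w` one for `(q, m)`. The shooting solution for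
`p` is positive on `(0, 1]` when the spectral parameter is very negative, by comparison with an
explicit positive function. A zero could enter only through the right end point, which would make
the boundary form at `1` nonpositive there and so force an eigenvalue below the lowest one. Hence
`u`, and likewise `w`, may be taken positive on `(0, 1)`.

If `l` is `m` times the supremum or infimum of `q / p`, then `l p - m q` has constant sign. The
Wronskian `u w' - u' w` has derivative `(l p - m q) u w` and is therefore monotone. Since `u` and
`w` satisfy the same boundary conditions, it vanishes at both end points, so it is identically zero
and `l p = m q` off a finite set.

The excluded parameters are those for which `l = 0`: then `u` is affine, and its nonnegative end
point values solve a linear system with determinant `cos α cos β - sin (α - β)`.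
-/

namespace VibratingString

theorem monotoneOn_of_hasDerivAt_nonneg_off_finset {f : ℝ → ℝ} (F : Finset ℝ) :
    ∀ {a b : ℝ}, ContinuousOn f (Icc a b) →
      (∀ x ∈ Ioo a b, x ∉ F → ∃ f' : ℝ, 0 ≤ f' ∧ HasDerivAt f f' x) → MonotoneOn f (Icc a b) := by
  induction F using Finset.induction_on with
  | empty =>
    intro a b hf hd
    replace hd : ∀ x ∈ interior (Icc a b), ∃ f' : ℝ, 0 ≤ f' ∧ HasDerivAt f f' x := by
      simpa only [interior_Icc, Finset.notMem_empty, not_false_eq_true, true_imp_iff] using hd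
    refine monotoneOn_of_deriv_nonneg (convex_Icc a b) hf (fun x hx => ?_) (fun x hx => ?_) <;>
      obtain ⟨f', hf', h⟩ := hd x hx
    · exact h.differentiableAt.differentiableWithinAt
    · exact h.deriv ▸ hf'
  | insert c F _ ih =>
    intro a b hf hd
    by_cases hc : c ∈ Ioo a b
    · have left : MonotoneOn f (Icc a c) := by
        refine ih (hf.mono (Icc_subset_Icc_right hc.2.le)) fun x hx hxF => ?_
        exact hd x ⟨hx.1, hx.2.trans hc.2⟩ (by simp [hx.2.ne, hxF])
      have right : MonotoneOn f (Icc c b) := by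
        refine ih (hf.mono (Icc_subset_Icc_left hc.1.le)) fun x hx hxF => ?_
        exact hd x ⟨hc.1.trans hx.1, hx.2⟩ (by simp [hx.1.ne', hxF])
      have := left.union_right right (isGreatest_Icc hc.1.le) (isLeast_Icc hc.2.le)
      rwa [Icc_union_Icc_eq_Icc hc.1.le hc.2.le] at this
    · refine ih hf fun x hx hxF => hd x hx ?_
      simp only [Finset.mem_insert, hxF, or_false]
      exact fun h => hc (h ▸ hx)

theorem pos_on_Ioc_of_no_first_zero {f : ℝ → ℝ} {a b : ℝ} (hf : ContinuousOn f (Icc a b))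
    (ha : ∀ᶠ x in 𝓝[>] a, 0 < f x)
    (h : ∀ y ∈ Ioc a b, (∀ x ∈ Ioo a y, 0 < f x) → f y ≠ 0) : ∀ x ∈ Ioc a b, 0 < f x := by
  by_contra! ⟨z, hz, hfz⟩
  obtain ⟨c, hac, hc⟩ := mem_nhdsGT_iff_exists_Ioo_subset.1 ha
  have hclosed : IsClosed {x ∈ Icc (min c z) b | f x ≤ 0} :=
    (hf.mono (Icc_subset_Icc_left (le_min hac.le hz.1.le))).preimage_isClosed_of_isClosed
      isClosed_Icc isClosed_Iic
  obtain ⟨y, ⟨hy, hfy⟩, hmin⟩ := (isCompact_Icc.of_isClosed_subset hclosed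
    (sep_subset _ _)).exists_isLeast ⟨z, ⟨min_le_right _ _, hz.2⟩, hfz⟩
  have hay : a < y := (lt_min hac hz.1).trans_le hy.1
  have hpos : ∀ x ∈ Ioo a y, 0 < f x := by
    intro x hx
    rcases lt_or_ge x (min c z) with hlt | hge
    · exact hc ⟨hx.1, hlt.trans_le (min_le_left _ _)⟩
    · by_contra! hfx
      exact (hmin ⟨⟨hge, hx.2.le.trans hy.2⟩, hfx⟩).not_gt hx.2
  have hfy0 : 0 ≤ f y := by
    have : (𝓝[Ioo a y] y).NeBot := right_nhdsWithin_Ioo_neBot hay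
    exact ge_of_tendsto ((hf y ⟨hay.le, hy.2⟩).mono
      (Ioo_subset_Icc_self.trans (Icc_subset_Icc_right hy.2)))
      (eventually_mem_nhdsWithin.mono fun x hx => (hpos x hx).le)
  exact h y ⟨hay, hy.2⟩ hpos (le_antisymm hfy hfy0)

/-- `u` is a real solution of `-u'' = P u` on `[0,1]` with derivative `v`, in the sense of
`IsSolution`, for a general coefficient `P`. -/
structure IsRealSolution (P u v : ℝ → ℝ) : Prop where
  hasDeriv : ∀ x ∈ Icc (0 : ℝ) 1, HasDerivWithinAt u (v x) (Icc 0 1) x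
  continuousOn_deriv : ContinuousOn v (Icc 0 1)
  equation : ∃ F : Finset ℝ, ∀ x ∈ Ioo (0 : ℝ) 1, x ∉ F → HasDerivAt v (-(P x * u x)) x

/-- The Wronskian `u w' - u' w` of `u` and `w`, where `v = u'`. -/
def wronskian (u v w w' : ℝ → ℝ) (x : ℝ) : ℝ := u x * w' x - v x * w x

/-- The value `a cos γ + b sin γ` of the separated boundary condition with parameter `γ` on a
function with value `a` and derivative `b`. -/
noncomputable def robin (γ a b : ℝ) : ℝ := a * Real.cos γ + b * Real.sin γ

theorem mul_sub_mul_eq_zero_of_robin_eq_zero {γ a b c d : ℝ} (h : robin γ a b = 0)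
    (k : robin γ c d = 0) : a * d - b * c = 0 := by
  have hcos : (a * d - b * c) * Real.cos γ = 0 := by
    unfold robin at h k; linear_combination d * h - b * k
  have hsin : (a * d - b * c) * Real.sin γ = 0 := by
    unfold robin at h k; linear_combination a * k - c * h
  linear_combination Real.cos γ * hcos + Real.sin γ * hsin -
    (a * d - b * c) * Real.sin_sq_add_cos_sq γ

namespace IsRealSolution

variable {P Q u v w w' : ℝ → ℝ}

theorem continuousOn (h : IsRealSolution P u v) : ContinuousOn u (Icc 0 1) :=
  fun x hx => (h.hasDeriv x hx).continuousWithinAt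

theorem hasDerivAt (h : IsRealSolution P u v) {x : ℝ} (hx : x ∈ Ioo (0 : ℝ) 1) :
    HasDerivAt u (v x) x :=
  (h.hasDeriv x (Ioo_subset_Icc_self hx)).hasDerivAt (Icc_mem_nhds hx.1 hx.2)

theorem continuousOn_wronskian (h : IsRealSolution P u v) (k : IsRealSolution Q w w') :
    ContinuousOn (wronskian u v w w') (Icc 0 1) :=
  (h.continuousOn.mul k.continuousOn_deriv).sub (h.continuousOn_deriv.mul k.continuousOn)

theorem hasDerivAt_wronskian (h : IsRealSolution P u v) (k : IsRealSolution Q w w') :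
    ∃ F : Finset ℝ, ∀ x ∈ Ioo (0 : ℝ) 1, x ∉ F →
      HasDerivAt (wronskian u v w w') ((P x - Q x) * (u x * w x)) x := by
  obtain ⟨F, hF⟩ := h.equation
  obtain ⟨G, hG⟩ := k.equation
  refine ⟨F ∪ G, fun x hx hxFG => ?_⟩
  simp only [Finset.mem_union, not_or] at hxFG
  refine (((h.hasDerivAt hx).mul (hG x hx hxFG.2)).sub
    ((hF x hx hxFG.1).mul (k.hasDerivAt hx))).congr_deriv ?_
  ring

theorem monotoneOn_wronskian (h : IsRealSolution P u v) (k : IsRealSolution Q w w') {c : ℝ}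
    (hc : c ≤ 1) (hs : ∀ x ∈ Ioo 0 c, 0 ≤ (P x - Q x) * (u x * w x)) :
    MonotoneOn (wronskian u v w w') (Icc 0 c) := by
  obtain ⟨F, hF⟩ := h.hasDerivAt_wronskian k
  exact monotoneOn_of_hasDerivAt_nonneg_off_finset F
    ((h.continuousOn_wronskian k).mono (Icc_subset_Icc_right hc))
    fun x hx hxF => ⟨_, hs x hx, hF x ⟨hx.1, hx.2.trans_le hc⟩ hxF⟩

theorem antitoneOn_wronskian (h : IsRealSolution P u v) (k : IsRealSolution Q w w') {c : ℝ}
    (hc : c ≤ 1) (hs : ∀ x ∈ Ioo 0 c, (P x - Q x) * (u x * w x) ≤ 0) :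
    AntitoneOn (wronskian u v w w') (Icc 0 c) := by
  have hswap : wronskian u v w w' = -wronskian w w' u v := by
    ext x; simp only [wronskian, Pi.neg_apply]; ring
  rw [hswap]
  exact (k.monotoneOn_wronskian h hc fun x hx => by linarith [hs x hx]).neg

theorem wronskian_eq (h : IsRealSolution P u v) (k : IsRealSolution P w w') {x : ℝ}
    (hx : x ∈ Icc (0 : ℝ) 1) : wronskian u v w w' x = wronskian u v w w' 0 :=
  le_antisymm
    (h.antitoneOn_wronskian k le_rfl (fun x _ => by simp) (left_mem_Icc.2 zero_le_one) hx hx.1)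
    (h.monotoneOn_wronskian k le_rfl (fun x _ => by simp) (left_mem_Icc.2 zero_le_one) hx hx.1)

theorem coeff_eq_off_finset (h : IsRealSolution P u v) (k : IsRealSolution Q w w')
    (hu : ∀ x ∈ Ioo (0 : ℝ) 1, 0 < u x) (hw : ∀ x ∈ Ioo (0 : ℝ) 1, 0 < w x)
    (h0 : wronskian u v w w' 0 = 0) (h1 : wronskian u v w w' 1 = 0)
    (hQP : ∀ x ∈ Ioo (0 : ℝ) 1, Q x ≤ P x) :
    ∃ F : Finset ℝ, ∀ x ∈ Ioo (0 : ℝ) 1, x ∉ F → P x = Q x := by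
  have hmono : MonotoneOn (wronskian u v w w') (Icc 0 1) :=
    h.monotoneOn_wronskian k le_rfl fun x hx =>
      mul_nonneg (sub_nonneg.2 (hQP x hx)) (mul_pos (hu x hx) (hw x hx)).le
  have hzero : ∀ x ∈ Icc (0 : ℝ) 1, wronskian u v w w' x = 0 := fun x hx =>
    le_antisymm (h1 ▸ hmono hx (right_mem_Icc.2 zero_le_one) hx.2)
      (h0 ▸ hmono (left_mem_Icc.2 zero_le_one) hx hx.1)
  obtain ⟨F, hF⟩ := h.hasDerivAt_wronskian k
  refine ⟨F, fun x hx hxF => ?_⟩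
  have hev : wronskian u v w w' =ᶠ[𝓝 x] fun _ => 0 :=
    (eventually_of_mem (Icc_mem_nhds hx.1 hx.2) hzero)
  have hd : (P x - Q x) * (u x * w x) = 0 :=
    (hF x hx hxF).unique ((hasDerivAt_const x (0 : ℝ)).congr_of_eventuallyEq hev)
  exact sub_eq_zero.1 ((mul_eq_zero.1 hd).resolve_right (mul_pos (hu x hx) (hw x hx)).ne')

theorem deriv_nonpos_of_pos_left (h : IsRealSolution P u v) {y : ℝ} (hy : y ∈ Ioc (0 : ℝ) 1)
    (hpos : ∀ x ∈ Ioo 0 y, 0 < u x) (huy : u y = 0) : v y ≤ 0 := by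
  have hd : HasDerivWithinAt u (v y) (Iio y) y := by
    refine (h.hasDeriv y (Ioc_subset_Icc_self hy)).mono_of_mem_nhdsWithin ?_
    filter_upwards [Ioo_mem_nhdsLT hy.1] with x hx using ⟨hx.1.le, hx.2.le.trans hy.2⟩
  refine le_of_tendsto ((hasDerivWithinAt_iff_tendsto_slope' (by simp)).1 hd) ?_
  filter_upwards [Ioo_mem_nhdsLT hy.1] with x hx
  rw [slope_def_field, huy, sub_zero]
  exact div_nonpos_of_nonneg_of_nonpos (hpos x hx).le (by linarith [hx.2])

theorem pos_of_deriv_pos (h : IsRealSolution P u v) (h0 : 0 ≤ u 0) {x : ℝ}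
    (hx : x ∈ Ioc (0 : ℝ) 1) (hv : ∀ t ∈ Ioo 0 x, 0 < v t) : 0 < u x := by
  have hmono : StrictMonoOn u (Icc 0 x) := by
    refine strictMonoOn_of_hasDerivWithinAt_pos (f' := v) (convex_Icc 0 x)
      (h.continuousOn.mono (Icc_subset_Icc_right hx.2)) (fun t ht => ?_) (fun t ht => ?_) <;>
      rw [interior_Icc] at ht
    · exact (h.hasDerivAt ⟨ht.1, ht.2.trans_le hx.2⟩).hasDerivWithinAt
    · exact hv t ht
  exact h0.trans_lt (hmono (left_mem_Icc.2 hx.1.le) (right_mem_Icc.2 hx.1.le) hx.1)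

theorem eventually_pos_nhdsGT_zero (h : IsRealSolution P u v) (h0 : 0 ≤ u 0)
    (h0' : u 0 = 0 → 0 < v 0) : ∀ᶠ x in 𝓝[>] (0 : ℝ), 0 < u x := by
  have hsub : 𝓝[>] (0 : ℝ) ≤ 𝓝[Icc 0 1] 0 :=
    nhdsWithin_le_of_mem (Icc_mem_nhdsGT zero_lt_one)
  have mem0 : (0 : ℝ) ∈ Icc (0 : ℝ) 1 := left_mem_Icc.2 zero_le_one
  rcases h0.eq_or_lt with hu0 | hu0
  · have hv : ∀ᶠ x in 𝓝[>] (0 : ℝ), 0 < v x :=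
      ((h.continuousOn_deriv 0 mem0).mono_left hsub).eventually (lt_mem_nhds (h0' hu0.symm))
    obtain ⟨δ, hδ, hvδ⟩ := mem_nhdsGT_iff_exists_Ioo_subset.1 hv
    filter_upwards [Ioo_mem_nhdsGT (lt_min hδ one_pos)] with x hx
    exact h.pos_of_deriv_pos h0 ⟨hx.1, (hx.2.trans_le (min_le_right _ _)).le⟩ fun t ht =>
      hvδ ⟨ht.1, ht.2.trans (hx.2.trans_le (min_le_left _ _))⟩
  · exact ((h.continuousOn 0 mem0).mono_left hsub).eventually (lt_mem_nhds hu0)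

theorem pos_and_wronskian_neg_of_coeff_le (h : IsRealSolution P u v) (k : IsRealSolution Q w w')
    (hPQ : ∀ x ∈ Ioo (0 : ℝ) 1, P x ≤ Q x) (hw : ∀ x ∈ Icc (0 : ℝ) 1, 0 < w x) (h0 : 0 ≤ u 0)
    (hW : wronskian u v w w' 0 < 0) :
    (∀ x ∈ Ioc (0 : ℝ) 1, 0 < u x) ∧ wronskian u v w w' 1 < 0 := by
  have hWneg : ∀ y ∈ Ioc (0 : ℝ) 1, (∀ x ∈ Ioo 0 y, 0 < u x) → wronskian u v w w' y < 0 := by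
    intro y hy hpos
    have hanti : AntitoneOn (wronskian u v w w') (Icc 0 y) :=
      h.antitoneOn_wronskian k hy.2 fun x hx =>
        have hx' : x ∈ Ioo (0 : ℝ) 1 := ⟨hx.1, hx.2.trans_le hy.2⟩
        mul_nonpos_of_nonpos_of_nonneg (sub_nonpos.2 (hPQ x hx'))
          (mul_pos (hpos x hx) (hw x (Ioo_subset_Icc_self hx'))).le
    exact (hanti (left_mem_Icc.2 hy.1.le) (right_mem_Icc.2 hy.1.le) hy.1.le).trans_lt hW
  have hv_pos : ∀ y ∈ Icc (0 : ℝ) 1, wronskian u v w w' y < 0 → u y = 0 → 0 < v y := by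
    intro y hy hWy huy
    rw [wronskian, huy, zero_mul, zero_sub, neg_lt_zero] at hWy
    exact pos_of_mul_pos_left hWy (hw y hy).le
  have hu : ∀ x ∈ Ioc (0 : ℝ) 1, 0 < u x :=
    pos_on_Ioc_of_no_first_zero h.continuousOn
      (h.eventually_pos_nhdsGT_zero h0 (hv_pos 0 (left_mem_Icc.2 zero_le_one) hW))
      fun y hy hpos huy => (h.deriv_nonpos_of_pos_left hy hpos huy).not_gt
        (hv_pos y (Ioc_subset_Icc_self hy) (hWneg y hy hpos) huy)
  exact ⟨hu, hWneg 1 (right_mem_Ioc.2 one_pos) fun x hx => hu x (Ioo_subset_Ioc_self hx)⟩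

end IsRealSolution

theorem PiecewiseContinuous.isBounded_image {p : ℝ → ℝ} (hp : PiecewiseContinuous p) :
    Bornology.IsBounded (p '' Icc 0 1) := by
  refine isCompact_Icc.induction_on (p := fun s => Bornology.IsBounded (p '' s)) (by simp)
    (fun s t hst ht => ht.subset (image_mono hst))
    (fun s t hs ht => image_union p s t ▸ hs.union ht) fun x hx => ?_
  have hleft : ∃ s ∈ 𝓝[Ico 0 x] x, Bornology.IsBounded (p '' s) := by
    rcases hx.1.eq_or_lt with rfl | h0
    · exact ⟨∅, by simp, by simp⟩
    · obtain ⟨l, hl⟩ := hp.2.2 x ⟨h0, hx.2⟩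
      rw [nhdsWithin_Ico_eq_nhdsLT h0]
      exact Metric.exists_isBounded_image_of_tendsto hl
  have hright : ∃ s ∈ 𝓝[Ioc x 1] x, Bornology.IsBounded (p '' s) := by
    rcases hx.2.eq_or_lt with rfl | h1
    · exact ⟨∅, by simp, by simp⟩
    · obtain ⟨l, hl⟩ := hp.2.1 x ⟨hx.1, h1⟩
      rw [nhdsWithin_Ioc_eq_nhdsGT h1]
      exact Metric.exists_isBounded_image_of_tendsto hl
  obtain ⟨s, hs, hps⟩ := hleft
  obtain ⟨t, ht, hpt⟩ := hright
  refine ⟨insert x (s ∪ t), ?_, ?_⟩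
  · rw [← Icc_union_Ioc_eq_Icc hx.1 hx.2, ← Ico_insert_right hx.1, nhdsWithin_union,
      nhdsWithin_insert]
    exact ⟨⟨mem_insert x _, mem_of_superset hs fun y hy => Or.inr (Or.inl hy)⟩,
      mem_of_superset ht fun y hy => Or.inr (Or.inr hy)⟩
  · rw [image_insert_eq, image_union]
    exact (hps.union hpt).insert _

open MeasureTheory in
theorem PiecewiseContinuous.aestronglyMeasurable {p : ℝ → ℝ} (hp : PiecewiseContinuous p) :
    AEStronglyMeasurable p (volume.restrict (Icc 0 1)) := by
  obtain ⟨F, hF⟩ := hp.1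
  have hcont : ContinuousOn p (Icc (0 : ℝ) 1 \ F) := fun x hx =>
    (hF x hx.1 hx.2).mono sdiff_subset
  have := hcont.aestronglyMeasurable (μ := volume) (measurableSet_Icc.diff F.measurableSet)
  rwa [Measure.restrict_congr_set
    (sdiff_null_ae_eq_self (F.finite_toSet.measure_zero volume))] at this

section Neumann

theorem isUnit_one_sub_of_summable_pow {R : Type*} [Ring R] [TopologicalSpace R]
    [IsTopologicalRing R] [T2Space R] {a : R} (ha : Summable (a ^ · : ℕ → R)) : IsUnit (1 - a) :=
  ⟨⟨1 - a, ∑' n, a ^ n, ha.one_sub_mul_tsum_pow, ha.tsum_pow_mul_one_sub⟩, rfl⟩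

theorem isUnit_one_sub_smul_of_norm_pow_le {𝕜 A : Type*} [NormedField 𝕜] [NormedRing A]
    [NormedAlgebra 𝕜 A] [CompleteSpace A] {a : A} {K : ℝ}
    (ha : ∀ n : ℕ, ‖a ^ n‖ ≤ K ^ n / n.factorial) (z : 𝕜) : IsUnit (1 - z • a) := by
  refine isUnit_one_sub_of_summable_pow
    (.of_norm_bounded (Real.summable_pow_div_factorial (‖z‖ * K)) fun n => ?_)
  rw [smul_pow, norm_smul, norm_pow, mul_pow, mul_div_assoc]
  exact mul_le_mul_of_nonneg_left (ha n) (by positivity)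

theorem exists_continuous_resolvent {𝕜 E : Type*} [NontriviallyNormedField 𝕜]
    [NormedAddCommGroup E] [NormedSpace 𝕜 E] [CompleteSpace E] {T : E →L[𝕜] E}
    (hT : ∀ z : 𝕜, IsUnit (1 - z • T)) (φ : E) :
    ∃ s : 𝕜 → E, Continuous s ∧ ∀ z, s z = φ + z • T (s z) := by
  refine ⟨fun z => Ring.inverse (1 - z • T) φ, ?_, fun z => ?_⟩
  · have : Continuous fun z : 𝕜 => Ring.inverse (1 - z • T) := by
      refine continuous_iff_continuousAt.2 fun z => ?_
      obtain ⟨y, hy⟩ := hT z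
      exact ContinuousAt.comp (g := Ring.inverse) (f := fun z : 𝕜 => 1 - z • T)
        (hy ▸ NormedRing.inverse_continuousAt y) (by fun_prop)
    exact this.clm_apply continuous_const
  · have := congrArg (fun A : E →L[𝕜] E => A φ) (Ring.mul_inverse_cancel _ (hT z))
    exact sub_eq_iff_eq_add.1 this

end Neumann

section Volterra

open MeasureTheory
open scoped unitInterval

/-- A measurable function on `[0,1]` bounded by `K`: the weights for which the Volterra operator
`f ↦ ∫₀ˣ g f` acts on continuous functions. -/
structure IsBoundedWeight (g : ℝ → ℝ) (K : ℝ) : Prop where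
  measurable : AEStronglyMeasurable g (volume.restrict (Icc 0 1))
  bound : ∀ x ∈ Icc (0 : ℝ) 1, |g x| ≤ K

variable {g : ℝ → ℝ} {K : ℝ}

theorem isBoundedWeight_one : IsBoundedWeight (fun _ => 1) 1 :=
  ⟨aestronglyMeasurable_const, fun _ _ => by simp⟩

theorem PiecewiseContinuous.exists_isBoundedWeight {p : ℝ → ℝ} (hp : PiecewiseContinuous p) :
    ∃ K, IsBoundedWeight p K := by
  obtain ⟨K, hK⟩ := hp.isBounded_image.exists_norm_le
  exact ⟨K, hp.aestronglyMeasurable, fun x hx => hK _ (mem_image_of_mem p hx)⟩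

namespace IsBoundedWeight

theorem nonneg (hg : IsBoundedWeight g K) : 0 ≤ K :=
  (abs_nonneg _).trans (hg.bound 0 (left_mem_Icc.2 zero_le_one))

theorem integrableOn (hg : IsBoundedWeight g K) (f : C(I, ℝ)) :
    IntegrableOn (fun t => g t * IccExtend zero_le_one f t) (Icc 0 1) := by
  have hf : Continuous (IccExtend zero_le_one f) := f.continuous.Icc_extend'
  refine Integrable.of_bound (hg.measurable.mul hf.aestronglyMeasurable) (K * ‖f‖) ?_
  filter_upwards [ae_restrict_mem measurableSet_Icc] with x hx
  rw [norm_mul]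
  exact mul_le_mul (hg.bound x hx) (f.norm_coe_le_norm _) (norm_nonneg _) hg.nonneg

theorem intervalIntegrable (hg : IsBoundedWeight g K) (f : C(I, ℝ)) {x : ℝ} (hx : x ∈ I) :
    IntervalIntegrable (fun t => g t * IccExtend zero_le_one f t) volume 0 x := by
  rw [intervalIntegrable_iff_integrableOn_Icc_of_le hx.1]
  exact (hg.integrableOn f).mono_set (Icc_subset_Icc_right hx.2)

theorem continuous_primitive (hg : IsBoundedWeight g K) (f : C(I, ℝ)) :
    Continuous fun x : I => ∫ t in (0 : ℝ)..x, g t * IccExtend zero_le_one f t := by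
  have h01 : uIcc (0 : ℝ) 1 = I := uIcc_of_le zero_le_one
  exact continuousOn_iff_continuous_domRestrict.1
    ((intervalIntegral.continuousOn_primitive_interval (h01.symm ▸ hg.integrableOn f)).mono h01.ge)

theorem abs_integral_le (hg : IsBoundedWeight g K) (f : C(I, ℝ)) {c : ℝ} {n : ℕ}
    (hf : ∀ t : I, |f t| ≤ c * (t : ℝ) ^ n) {x : ℝ} (hx : x ∈ I) :
    |∫ t in (0 : ℝ)..x, g t * IccExtend zero_le_one f t| ≤ K * c / (n + 1) * x ^ (n + 1) := by
  calc |∫ t in (0 : ℝ)..x, g t * IccExtend zero_le_one f t|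
      ≤ ∫ t in (0 : ℝ)..x, K * c * t ^ n := by
        rw [← Real.norm_eq_abs]
        refine intervalIntegral.norm_integral_le_of_norm_le hx.1 (ae_of_all _ fun t ht => ?_)
          ((by fun_prop : Continuous fun t : ℝ => K * c * t ^ n).intervalIntegrable 0 x)
        have ht' : t ∈ I := ⟨ht.1.le, ht.2.trans hx.2⟩
        rw [norm_mul, IccExtend_of_mem _ _ ht', mul_assoc]
        exact mul_le_mul (hg.bound t ht') (hf ⟨t, ht'⟩) (norm_nonneg _) hg.nonneg
    _ = K * c / (n + 1) * x ^ (n + 1) := by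
        rw [intervalIntegral.integral_const_mul, integral_pow, zero_pow n.succ_ne_zero]
        ring

/-- The Volterra operator `f ↦ ∫₀ˣ g f` on `C([0,1])` with weight `g`. -/
noncomputable def volterra (hg : IsBoundedWeight g K) : C(I, ℝ) →L[ℝ] C(I, ℝ) :=
  LinearMap.mkContinuous
    { toFun := fun f =>
        ⟨fun x => ∫ t in (0 : ℝ)..x, g t * IccExtend zero_le_one f t, hg.continuous_primitive f⟩
      map_add' := fun f₁ f₂ => by
        ext x
        simp only [ContinuousMap.coe_mk, ContinuousMap.add_apply]
        rw [← intervalIntegral.integral_add (hg.intervalIntegrable f₁ x.2)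
          (hg.intervalIntegrable f₂ x.2)]
        simp only [IccExtend, Function.comp_apply, ContinuousMap.add_apply, mul_add]
      map_smul' := fun c f => by
        ext x
        simp only [ContinuousMap.coe_mk, ContinuousMap.smul_apply, RingHom.id_apply, smul_eq_mul]
        rw [← intervalIntegral.integral_const_mul]
        simp only [IccExtend, Function.comp_apply, ContinuousMap.smul_apply, smul_eq_mul,
          mul_left_comm] }
    K (fun f => by
      refine (ContinuousMap.norm_le _ (mul_nonneg hg.nonneg (norm_nonneg _))).2 fun x => ?_
      refine (hg.abs_integral_le f (c := ‖f‖) (n := 0)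
        (fun t => by simpa using f.norm_coe_le_norm t) x.2).trans ?_
      simpa using mul_le_mul_of_nonneg_left x.2.2 (mul_nonneg hg.nonneg (norm_nonneg f)))

theorem volterra_zero (hg : IsBoundedWeight g K) (f : C(I, ℝ)) : hg.volterra f 0 = 0 :=
  intervalIntegral.integral_same

theorem hasDerivWithinAt_volterra (hg : IsBoundedWeight g K) (f : C(I, ℝ)) {x : ℝ} (hx : x ∈ I)
    (hgx : ContinuousWithinAt g I x) :
    HasDerivWithinAt (IccExtend zero_le_one (hg.volterra f))
      (g x * IccExtend zero_le_one f x) I x := by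
  have : Fact (x ∈ Icc (0 : ℝ) 1) := ⟨hx⟩
  have hcont : ContinuousWithinAt (fun t => g t * IccExtend zero_le_one f t) I x :=
    hgx.mul (f.continuous.Icc_extend' (h := zero_le_one)).continuousWithinAt
  refine (intervalIntegral.integral_hasDerivWithinAt_right (hg.intervalIntegrable f hx)
    ⟨Icc 0 1, self_mem_nhdsWithin, (hg.integrableOn f).aestronglyMeasurable⟩ hcont).congr
    (fun y hy => ?_) ?_ <;>
  exact IccExtend_of_mem _ _ ‹_›

/-- The operator `f ↦ ∫₀ˣ ∫₀ˢ g f` on `C([0,1])`, which inverts `u'' = g f` with zero initial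
data. -/
noncomputable def doubleVolterra (hg : IsBoundedWeight g K) : C(I, ℝ) →L[ℝ] C(I, ℝ) :=
  isBoundedWeight_one.volterra ∘L hg.volterra

theorem abs_doubleVolterra_le (hg : IsBoundedWeight g K) (f : C(I, ℝ)) {c : ℝ} {n : ℕ}
    (hc : 0 ≤ c) (hf : ∀ t : I, |f t| ≤ c * (t : ℝ) ^ n) (x : I) :
    |hg.doubleVolterra f x| ≤ K * c / (n + 1) * (x : ℝ) ^ (n + 1) := by
  have hpos : 0 ≤ K * c / (n + 1) := div_nonneg (mul_nonneg hg.nonneg hc) (by positivity)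
  have hinner : ∀ t : I, |hg.volterra f t| ≤ K * c / (n + 1) * (t : ℝ) ^ (n + 1) :=
    fun t => hg.abs_integral_le f hf t.2
  calc |hg.doubleVolterra f x|
      ≤ 1 * (K * c / (n + 1)) / ((n + 1 : ℕ) + 1) * (x : ℝ) ^ (n + 1 + 1) :=
        isBoundedWeight_one.abs_integral_le (hg.volterra f) hinner x.2
    _ ≤ K * c / (n + 1) * (x : ℝ) ^ (n + 1) := by
        rw [one_mul]
        refine mul_le_mul (div_le_self hpos (le_add_of_nonneg_left (Nat.cast_nonneg _)))
          (pow_le_pow_of_le_one x.2.1 x.2.2 (Nat.le_succ _)) (pow_nonneg x.2.1 _) hpos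

theorem abs_doubleVolterra_pow_le (hg : IsBoundedWeight g K) (f : C(I, ℝ)) (n : ℕ) :
    ∀ x : I, |(hg.doubleVolterra ^ n) f x| ≤ K ^ n / n.factorial * ‖f‖ * (x : ℝ) ^ n := by
  induction n with
  | zero => intro x; simpa using f.norm_coe_le_norm x
  | succ n ih =>
    intro x
    have hc : 0 ≤ K ^ n / n.factorial * ‖f‖ :=
      mul_nonneg (div_nonneg (pow_nonneg hg.nonneg _) (by positivity)) (norm_nonneg _)
    rw [pow_succ']
    refine (hg.abs_doubleVolterra_le _ hc ih x).trans_eq ?_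
    rw [Nat.factorial_succ]
    push_cast
    field_simp
    ring

theorem norm_doubleVolterra_pow_le (hg : IsBoundedWeight g K) (n : ℕ) :
    ‖hg.doubleVolterra ^ n‖ ≤ K ^ n / n.factorial := by
  have hn : 0 ≤ K ^ n / n.factorial := div_nonneg (pow_nonneg hg.nonneg _) (by positivity)
  refine ContinuousLinearMap.opNorm_le_bound _ hn fun f => ?_
  refine (ContinuousMap.norm_le _ (mul_nonneg hn (norm_nonneg _))).2 fun x => ?_
  exact (hg.abs_doubleVolterra_pow_le f n x).trans
    (mul_le_of_le_one_right (mul_nonneg hn (norm_nonneg _)) (pow_le_one₀ x.2.1 x.2.2))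

end IsBoundedWeight

/-- The solutions `U z` of `-u'' = z p u` with `u(0) = a`, `u'(0) = b`, and their derivatives
`V z`, depending continuously on the spectral parameter `z`. -/
structure IsSolutionFamily (p : ℝ → ℝ) (a b : ℝ) (U V : ℝ → ℝ → ℝ) : Prop where
  isRealSolution : ∀ z, IsRealSolution (fun x => z * p x) (U z) (V z)
  left : ∀ z, U z 0 = a
  left_deriv : ∀ z, V z 0 = b
  continuous : Continuous (Function.uncurry U)
  continuous_deriv : Continuous (Function.uncurry V)

theorem isRealSolution_of_eq_add_volterra {p : ℝ → ℝ} (hp : PiecewiseContinuous p)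
    (hK : IsBoundedWeight p K) {a b z : ℝ} {u v : C(I, ℝ)}
    (hu : u = .const I a + isBoundedWeight_one.volterra v)
    (hv : v = .const I b - z • hK.volterra u) :
    IsRealSolution (fun x => z * p x) (IccExtend zero_le_one u) (IccExtend zero_le_one v) := by
  obtain ⟨F, hF⟩ := hp.1
  refine ⟨fun x hx => ?_, v.continuous.Icc_extend'.continuousOn, F, fun x hx hxF => ?_⟩
  · have hd := (isBoundedWeight_one.hasDerivWithinAt_volterra v hx
      continuousWithinAt_const).const_add a
    rw [one_mul] at hd
    refine hd.congr (fun y _ => ?_) ?_ <;> exact congrFun (congrArg _ hu) _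
  · have hxI : x ∈ I := Ioo_subset_Icc_self hx
    have hd := ((hK.hasDerivWithinAt_volterra u hxI (hF x hxI hxF)).const_mul z).const_sub b
    rw [← mul_assoc] at hd
    refine (hd.congr (fun y _ => ?_) ?_).hasDerivAt (Icc_mem_nhds hx.1 hx.2) <;>
    exact congrFun (congrArg _ hv) _

theorem PiecewiseContinuous.exists_isSolutionFamily {p : ℝ → ℝ} (hp : PiecewiseContinuous p)
    (a b : ℝ) : ∃ U V, IsSolutionFamily p a b U V := by
  obtain ⟨K, hK⟩ := hp.exists_isBoundedWeight
  obtain ⟨s, hs, hs_eq⟩ := exists_continuous_resolvent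
    (isUnit_one_sub_smul_of_norm_pow_le (𝕜 := ℝ) hK.norm_doubleVolterra_pow_le)
    (.const I a + isBoundedWeight_one.volterra (.const I b))
  let u : ℝ → C(I, ℝ) := fun z => s (-z)
  let v : ℝ → C(I, ℝ) := fun z => .const I b - z • hK.volterra (u z)
  have hu : ∀ z, u z = .const I a + isBoundedWeight_one.volterra (v z) := fun z => by
    rw [map_sub, map_smul, add_sub, sub_eq_add_neg, ← neg_smul]
    exact hs_eq (-z)
  have hu_cont : Continuous u := hs.comp continuous_neg
  have hv_cont : Continuous v := by fun_prop
  have joint : ∀ {r : ℝ → C(I, ℝ)}, Continuous r →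
      Continuous (Function.uncurry fun z => IccExtend zero_le_one (r z)) := fun hr =>
    (hr.comp continuous_fst).eval (continuous_projIcc.comp continuous_snd)
  refine ⟨fun z => IccExtend zero_le_one (u z), fun z => IccExtend zero_le_one (v z),
    fun z => isRealSolution_of_eq_add_volterra hp hK (hu z) rfl, fun z => ?_, fun z => ?_,
    joint hu_cont, joint hv_cont⟩
  · have := congrArg (· 0) (hu z)
    simpa [IsBoundedWeight.volterra_zero] using this
  · simp [v, IsBoundedWeight.volterra_zero]

end Volterra

theorem IsRealSolution.eq_zero_of_eq_zero_at {p u v : ℝ → ℝ} {z x₀ : ℝ}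
    (hp : PiecewiseContinuous p) (h : IsRealSolution (fun x => z * p x) u v)
    (hx₀ : x₀ ∈ Icc (0 : ℝ) 1) (hu : u x₀ = 0) (hv : v x₀ = 0) :
    ∀ x ∈ Icc (0 : ℝ) 1, u x = 0 ∧ v x = 0 := by
  obtain ⟨C, C', hC⟩ := hp.exists_isSolutionFamily 1 0
  obtain ⟨S, S', hS⟩ := hp.exists_isSolutionFamily 0 1
  intro x hx
  have hzero : ∀ {w w'}, IsRealSolution (fun x => z * p x) w w' → u x * w' x - v x * w x = 0 :=
    fun {w w'} k => calc
      wronskian u v w w' x = wronskian u v w w' x₀ :=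
        (h.wronskian_eq k hx).trans (h.wronskian_eq k hx₀).symm
      _ = 0 := by rw [wronskian, hu, hv, zero_mul, zero_mul, sub_zero]
  have hone : C z x * S' z x - C' z x * S z x = 1 := calc
    wronskian (C z) (C' z) (S z) (S' z) x = wronskian (C z) (C' z) (S z) (S' z) 0 :=
      (hC.isRealSolution z).wronskian_eq (hS.isRealSolution z) hx
    _ = 1 := by
      rw [wronskian, hC.left, hC.left_deriv, hS.left, hS.left_deriv]; norm_num
  have hWC := hzero (hC.isRealSolution z)
  have hWS := hzero (hS.isRealSolution z)
  exact ⟨by linear_combination C z x * hWS - S z x * hWC - u x * hone,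
    by linear_combination C' z x * hWS - S' z x * hWC - v x * hone⟩

namespace IsSolutionFamily

variable {p : ℝ → ℝ} {a b : ℝ} {U V : ℝ → ℝ → ℝ}

theorem deriv_ne_zero (hp : PiecewiseContinuous p) (h : IsSolutionFamily p a b U V)
    (hab : a ≠ 0 ∨ b ≠ 0) {z x : ℝ} (hx : x ∈ Icc (0 : ℝ) 1) (hU : U z x = 0) : V z x ≠ 0 := by
  intro hV
  obtain ⟨hU0, hV0⟩ := (h.isRealSolution z).eq_zero_of_eq_zero_at hp hx hU hV 0
    (left_mem_Icc.2 zero_le_one)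
  rw [h.left] at hU0
  rw [h.left_deriv] at hV0
  exact hab.elim (· hU0) (· hV0)

theorem eventually_pos_nhds_zero (h : IsSolutionFamily p a b U V) (ha : 0 ≤ a)
    (hb : a = 0 → 0 < b) (z : ℝ) :
    ∀ᶠ y : ℝ × ℝ in 𝓝 (z, 0), y.2 ∈ Ioc (0 : ℝ) 1 → 0 < U y.1 y.2 := by
  rcases ha.eq_or_lt with rfl | ha'
  · have hV : ∀ᶠ y : ℝ × ℝ in 𝓝 z ×ˢ 𝓝 0, 0 < V y.1 y.2 := by
      rw [← nhds_prod_eq]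
      refine h.continuous_deriv.continuousAt.eventually (lt_mem_nhds ?_)
      simpa only [Function.uncurry_apply_pair, h.left_deriv] using hb rfl
    obtain ⟨nearz, hnearz, near0, hnear0, hpos⟩ := eventually_prod_iff.1 hV
    obtain ⟨c, d, hcd, hsub⟩ := mem_nhds_iff_exists_Ioo_subset.1 hnear0
    rw [nhds_prod_eq]
    filter_upwards [hnearz.prod_mk (Ioo_mem_nhds hcd.1 hcd.2)] with y hy hy01
    exact (h.isRealSolution y.1).pos_of_deriv_pos (h.left _).ge hy01 fun t ht =>
      hpos hy.1 (hsub ⟨hcd.1.trans ht.1, ht.2.trans hy.2.2⟩)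
  · have hU : ∀ᶠ y : ℝ × ℝ in 𝓝 (z, 0), 0 < Function.uncurry U y :=
      h.continuous.continuousAt.eventually
        (lt_mem_nhds (by simpa only [Function.uncurry_apply_pair, h.left] using ha'))
    exact hU.mono fun y hy _ => hy

theorem isOpen_setOf_pos (h : IsSolutionFamily p a b U V) (ha : 0 ≤ a) (hb : a = 0 → 0 < b) :
    IsOpen {z : ℝ | ∀ x ∈ Ioc (0 : ℝ) 1, 0 < U z x} := by
  refine isOpen_iff_mem_nhds.2 fun z hz => ?_
  have hev : ∀ᶠ w in 𝓝 z, ∀ x ∈ Icc (0 : ℝ) 1, x ∈ Ioc (0 : ℝ) 1 → 0 < U w x := by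
    refine isCompact_Icc.eventually_forall_of_forall_eventually fun x hx => ?_
    rcases hx.1.eq_or_lt with rfl | h0
    · exact h.eventually_pos_nhds_zero ha hb z
    · have hU : ∀ᶠ y : ℝ × ℝ in 𝓝 (z, x), 0 < Function.uncurry U y :=
        h.continuous.continuousAt.eventually (lt_mem_nhds (hz x ⟨h0, hx.2⟩))
      exact hU.mono fun y hy _ => hy
  exact hev.mono fun w hw x hx => hw x (Ioc_subset_Icc_self hx) hx

theorem nonneg_of_mem_closure (h : IsSolutionFamily p a b U V) {z : ℝ}
    (hz : z ∈ closure {z : ℝ | ∀ x ∈ Ioc (0 : ℝ) 1, 0 < U z x}) :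
    ∀ x ∈ Ioc (0 : ℝ) 1, 0 ≤ U z x := fun x hx =>
  closure_minimal (fun _ hw => (hw x hx).le)
    (isClosed_le continuous_const (h.continuous.comp (.prodMk_left x))) hz

theorem pos_of_mem_closure (hp : PiecewiseContinuous p) (h : IsSolutionFamily p a b U V)
    (hab : a ≠ 0 ∨ b ≠ 0) {z : ℝ}
    (hz : z ∈ closure {z : ℝ | ∀ x ∈ Ioc (0 : ℝ) 1, 0 < U z x}) :
    ∀ x ∈ Ioo (0 : ℝ) 1, 0 < U z x := by
  intro x hx
  have hnonneg := h.nonneg_of_mem_closure hz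
  refine (hnonneg x (Ioo_subset_Ioc_self hx)).lt_of_ne fun hUx => ?_
  have hmin : IsLocalMin (U z) x := by
    filter_upwards [Ioo_mem_nhds hx.1 hx.2] with y hy
    exact hUx ▸ hnonneg y (Ioo_subset_Ioc_self hy)
  exact h.deriv_ne_zero hp hab (Ioo_subset_Icc_self hx) hUx.symm
    (hmin.hasDerivAt_eq_zero ((h.isRealSolution z).hasDerivAt hx))

end IsSolutionFamily

section RealEigenfunctions

theorem IsSolution.isRealSolution_comp {p : ℝ → ℝ} {z : ℝ} {u v : ℝ → ℂ}
    (h : IsSolution p z u v) (L : ℂ →L[ℝ] ℝ) :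
    IsRealSolution (fun x => z * p x) (fun x => L (u x)) (fun x => L (v x)) := by
  refine ⟨fun x hx => L.hasFDerivAt.comp_hasDerivWithinAt x (h.hasDeriv x hx),
    L.continuous.comp_continuousOn h.continuousOn_deriv, ?_⟩
  obtain ⟨F, hF⟩ := h.equation
  refine ⟨F, fun x hx hxF => ?_⟩
  obtain ⟨d, hd, hd_eq⟩ := hF x hx hxF
  refine (L.hasFDerivAt.comp_hasDerivAt x hd).congr_deriv ?_
  have : d = -((z * p x : ℝ) • u x) := by
    rw [← neg_eq_iff_eq_neg, hd_eq, Complex.real_smul, Complex.ofReal_mul]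
  rw [this, map_neg, map_smul, smul_eq_mul]

theorem IsRealSolution.isSolution_ofReal {p u v : ℝ → ℝ} {z : ℝ}
    (h : IsRealSolution (fun x => z * p x) u v) :
    IsSolution p z (fun x => (u x : ℂ)) (fun x => (v x : ℂ)) := by
  refine ⟨fun x hx => (h.hasDeriv x hx).ofReal_comp,
    Complex.continuous_ofReal.comp_continuousOn h.continuousOn_deriv, ?_⟩
  obtain ⟨F, hF⟩ := h.equation
  refine ⟨F, fun x hx hxF => ⟨_, (hF x hx hxF).ofReal_comp, ?_⟩⟩
  push_cast
  ring

theorem robin_clm_eq_zero (L : ℂ →L[ℝ] ℝ) {γ : ℝ} {a b : ℂ}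
    (h : a * (Real.cos γ : ℂ) + b * (Real.sin γ : ℂ) = 0) : robin γ (L a) (L b) = 0 := by
  have hsmul : Real.cos γ • a + Real.sin γ • b = 0 := by
    rw [Complex.real_smul, Complex.real_smul, mul_comm, mul_comm _ b, h]
  have := congrArg L hsmul
  rwa [map_add, map_smul, map_smul, map_zero, smul_eq_mul, smul_eq_mul, mul_comm, mul_comm _ (L b)]
    at this

theorem isEigenvalue_ofReal_iff {p : ℝ → ℝ} {α β z : ℝ} :
    IsEigenvalue p α β z ↔ ∃ u v : ℝ → ℝ, IsRealSolution (fun x => z * p x) u v ∧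
      robin α (u 0) (v 0) = 0 ∧ robin β (u 1) (v 1) = 0 ∧ ∃ x ∈ Icc (0 : ℝ) 1, u x ≠ 0 := by
  constructor
  · rintro ⟨u, v, hs, h0, h1, x, hx, hne⟩
    obtain ⟨L, hL⟩ : ∃ L : ℂ →L[ℝ] ℝ, L (u x) ≠ 0 := by
      by_contra! hall
      exact hne (Complex.ext (hall Complex.reCLM) (hall Complex.imCLM))
    exact ⟨_, _, hs.isRealSolution_comp L, robin_clm_eq_zero L h0, robin_clm_eq_zero L h1,
      x, hx, hL⟩
  · rintro ⟨u, v, hs, h0, h1, x, hx, hne⟩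
    exact ⟨_, _, hs.isSolution_ofReal, by exact_mod_cast h0, by exact_mod_cast h1, x, hx,
      by exact_mod_cast hne⟩

end RealEigenfunctions

/-- The shooting solutions: those with the initial data `u(0) = sin α`, `u'(0) = -cos α`, which
solve the boundary condition at `0`. -/
abbrev IsShootingFamily (p : ℝ → ℝ) (α : ℝ) (U V : ℝ → ℝ → ℝ) : Prop :=
  IsSolutionFamily p (Real.sin α) (-Real.cos α) U V

theorem sin_ne_zero_or_neg_cos_ne_zero (α : ℝ) : Real.sin α ≠ 0 ∨ -Real.cos α ≠ 0 := by
  by_contra! ⟨hs, hc⟩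
  simpa [hs, neg_eq_zero.1 hc] using Real.sin_sq_add_cos_sq α

theorem robin_eq_zero_of_mul_sub_mul_eq_zero {γ a b c d : ℝ} (h : robin γ a b = 0)
    (hab : a ≠ 0 ∨ b ≠ 0) (hW : a * d - b * c = 0) : robin γ c d = 0 := by
  have ha : a * robin γ c d = 0 := by
    unfold robin at h ⊢; linear_combination c * h + Real.sin γ * hW
  have hb : b * robin γ c d = 0 := by
    unfold robin at h ⊢; linear_combination d * h - Real.cos γ * hW
  exact hab.elim (mul_eq_zero.1 ha).resolve_left (mul_eq_zero.1 hb).resolve_left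

theorem IsRealSolution.deriv_eq_zero_of_eq_zero {P u v : ℝ → ℝ} (h : IsRealSolution P u v)
    (hu : ∀ x ∈ Icc (0 : ℝ) 1, u x = 0) {x : ℝ} (hx : x ∈ Icc (0 : ℝ) 1) : v x = 0 :=
  (uniqueDiffOn_Icc zero_lt_one x hx).eq_deriv _ (h.hasDeriv x hx)
    ((hasDerivWithinAt_const x _ (0 : ℝ)).congr hu (hu x hx))

theorem exists_cos_lt_mul_sin {γ : ℝ} (hγ : γ ∈ Ioc 0 Real.pi) :
    ∃ A : ℝ, Real.cos γ < A * Real.sin γ := by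
  rcases hγ.2.eq_or_lt with rfl | hlt
  · exact ⟨0, by simp⟩
  · refine ⟨(Real.cos γ + 1) / Real.sin γ, ?_⟩
    rw [div_mul_cancel₀ _ (Real.sin_pos_of_pos_of_lt_pi hγ.1 hlt).ne']
    exact lt_add_one _

theorem exists_pos_isRealSolution_of_log_deriv (A B : ℝ) :
    ∃ Q w w' : ℝ → ℝ, Continuous Q ∧ IsRealSolution Q w w' ∧ (∀ x, 0 < w x) ∧
      w' 0 = A * w 0 ∧ w' 1 = B * w 1 := by
  -- `w = exp φ` for the quadratic `φ` with `φ' = A` at `0` and `φ' = B` at `1`.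
  let φ : ℝ → ℝ := fun x => A * x + (B - A) * (x ^ 2 / 2)
  let φ' : ℝ → ℝ := fun x => A + (B - A) * x
  have hφ : ∀ x, HasDerivAt φ (φ' x) x := fun x =>
    (((hasDerivAt_id x).const_mul A).add
      ((((hasDerivAt_id x).pow 2).div_const 2).const_mul (B - A))).congr_deriv (by simp [φ'])
  have hφ' : ∀ x, HasDerivAt φ' (B - A) x := fun x =>
    (((hasDerivAt_id x).const_mul (B - A)).const_add A).congr_deriv (mul_one _)
  let w : ℝ → ℝ := fun x => Real.exp (φ x)
  have hw : ∀ x, HasDerivAt w (φ' x * w x) x := fun x =>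
    (hφ x).exp.congr_deriv (mul_comm _ _)
  let Q : ℝ → ℝ := fun x => -(B - A + φ' x ^ 2)
  have hw' : ∀ x, HasDerivAt (fun x => φ' x * w x) (-(Q x * w x)) x := fun x =>
    ((hφ' x).mul (hw x)).congr_deriv (by simp only [Q]; ring)
  refine ⟨Q, w, fun x => φ' x * w x, by fun_prop, ⟨fun x _ => (hw x).hasDerivWithinAt,
    fun x _ => (hw' x).continuousAt.continuousWithinAt, ∅, fun x _ _ => hw' x⟩,
    fun x => Real.exp_pos _, by simp [φ'], by simp [φ']⟩

theorem IsDensity.exists_forall_le_mul_le {p Q : ℝ → ℝ} (hp : IsDensity p)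
    (hQ : ContinuousOn Q (Icc 0 1)) :
    ∃ Λ : ℝ, ∀ z ≤ Λ, ∀ x ∈ Icc (0 : ℝ) 1, z * p x ≤ Q x := by
  obtain ⟨c, hc, hpc⟩ := hp.boundedAway
  obtain ⟨M, hM⟩ := isCompact_Icc.bddBelow_image hQ
  refine ⟨min M 0 / c, fun z hz x hx => ?_⟩
  have hzc : z * c ≤ min M 0 := (le_div_iff₀ hc).1 hz
  calc z * p x ≤ z * c := mul_le_mul_of_nonpos_left (hpc x hx)
        (nonpos_of_mul_nonpos_left (hzc.trans (min_le_right _ _)) hc)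
    _ ≤ M := hzc.trans (min_le_left _ _)
    _ ≤ Q x := hM (mem_image_of_mem Q hx)

/-- `u` is an eigenfunction for the eigenvalue `l` that is positive on `(0,1)`, and `v = u'`. -/
structure IsPositiveEigenfunction (p : ℝ → ℝ) (α β l : ℝ) (u v : ℝ → ℝ) : Prop where
  isRealSolution : IsRealSolution (fun x => l * p x) u v
  robin_left : robin α (u 0) (v 0) = 0
  robin_right : robin β (u 1) (v 1) = 0
  pos : ∀ x ∈ Ioo (0 : ℝ) 1, 0 < u x

namespace IsShootingFamily

variable {p : ℝ → ℝ} {α β : ℝ} {U V : ℝ → ℝ → ℝ}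

theorem robin_left (h : IsShootingFamily p α U V) (z : ℝ) : robin α (U z 0) (V z 0) = 0 := by
  rw [h.left, h.left_deriv, robin]
  ring

theorem isEigenvalue_iff (hp : PiecewiseContinuous p) (h : IsShootingFamily p α U V) {z : ℝ} :
    IsEigenvalue p α β z ↔ robin β (U z 1) (V z 1) = 0 := by
  have mem1 : (1 : ℝ) ∈ Icc (0 : ℝ) 1 := right_mem_Icc.2 zero_le_one
  rw [isEigenvalue_ofReal_iff]
  constructor
  · rintro ⟨u, v, hu, hu0, hu1, x, hx, hux⟩
    have hW : wronskian u v (U z) (V z) 1 = 0 := (hu.wronskian_eq (h.isRealSolution z) mem1).trans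
      (mul_sub_mul_eq_zero_of_robin_eq_zero hu0 (h.robin_left z))
    refine robin_eq_zero_of_mul_sub_mul_eq_zero hu1 ?_ hW
    by_contra! ⟨hu1, hv1⟩
    exact hux (hu.eq_zero_of_eq_zero_at hp mem1 hu1 hv1 x hx).1
  · refine fun h1 => ⟨U z, V z, h.isRealSolution z, h.robin_left z, h1, ?_⟩
    by_contra! hU
    have mem0 : (0 : ℝ) ∈ Icc (0 : ℝ) 1 := left_mem_Icc.2 zero_le_one
    exact h.deriv_ne_zero hp (sin_ne_zero_or_neg_cos_ne_zero α) mem0 (hU 0 mem0)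
      ((h.isRealSolution z).deriv_eq_zero_of_eq_zero hU mem0)

theorem continuous_robin_right (h : IsShootingFamily p α U V) :
    Continuous fun z => robin β (U z 1) (V z 1) :=
  ((h.continuous.comp (.prodMk_left 1)).mul_const _).add
    ((h.continuous_deriv.comp (.prodMk_left 1)).mul_const _)

theorem exists_forall_le_pos_and_robin_right_pos (hp : IsDensity p) (hα : α ∈ Ioc 0 Real.pi)
    (hβ : β ∈ Ico 0 Real.pi) (h : IsShootingFamily p α U V) :
    ∃ Λ : ℝ, ∀ z ≤ Λ, (∀ x ∈ Ioc (0 : ℝ) 1, 0 < U z x) ∧ 0 < robin β (U z 1) (V z 1) := by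
  obtain ⟨A, hA⟩ := exists_cos_lt_mul_sin hα
  obtain ⟨B, hB⟩ := exists_cos_lt_mul_sin (γ := Real.pi - β)
    ⟨sub_pos.2 hβ.2, sub_le_self _ hβ.1⟩
  rw [Real.cos_pi_sub, Real.sin_pi_sub] at hB
  obtain ⟨Q, w, w', hQ, hw, hwpos, hw0, hw1⟩ := exists_pos_isRealSolution_of_log_deriv (-A) B
  obtain ⟨Λ, hΛ⟩ := hp.exists_forall_le_mul_le hQ.continuousOn
  refine ⟨Λ, fun z hz => ?_⟩
  have hW0 : wronskian (U z) (V z) w w' 0 < 0 := by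
    rw [wronskian, h.left, h.left_deriv, hw0]
    linarith [mul_lt_mul_of_pos_right hA (hwpos 0)]
  obtain ⟨hUpos, hW1⟩ := (h.isRealSolution z).pos_and_wronskian_neg_of_coeff_le hw
    (fun x hx => hΛ z hz x (Ioo_subset_Icc_self hx)) (fun x _ => hwpos x)
    ((h.left z).symm ▸ Real.sin_nonneg_of_nonneg_of_le_pi hα.1.le hα.2) hW0
  refine ⟨hUpos, ?_⟩
  have hBV : B * U z 1 < V z 1 := by
    rw [wronskian, hw1] at hW1
    exact lt_of_mul_lt_mul_right (by linarith) (hwpos 1).le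
  calc 0 < U z 1 * (Real.cos β + B * Real.sin β) :=
        mul_pos (hUpos 1 (right_mem_Ioc.2 one_pos)) (by linarith)
    _ = U z 1 * Real.cos β + B * U z 1 * Real.sin β := by ring
    _ ≤ robin β (U z 1) (V z 1) := by
        unfold robin
        gcongr
        exact Real.sin_nonneg_of_nonneg_of_le_pi hβ.1 hβ.2.le

theorem robin_right_pos_of_lt (hp : IsDensity p) (hα : α ∈ Ioc 0 Real.pi)
    (hβ : β ∈ Ico 0 Real.pi) (h : IsShootingFamily p α U V) {l : ℝ}
    (hl : IsLowestEigenvalue p α β l) {z : ℝ} (hz : z < l) : 0 < robin β (U z 1) (V z 1) := by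
  obtain ⟨Λ, hΛ⟩ := h.exists_forall_le_pos_and_robin_right_pos hp hα hβ
  by_contra! hneg
  obtain ⟨y, hy, hy0⟩ := intermediate_value_Icc' (min_le_left z Λ)
    (h.continuous_robin_right (β := β)).continuousOn ⟨hneg, (hΛ _ (min_le_right z Λ)).2.le⟩
  have hyl : l ≤ y := hl.2 ((h.isEigenvalue_iff hp.piecewiseContinuous).2 hy0)
  exact (hyl.trans hy.2).not_gt hz

theorem pos_of_lt (hp : IsDensity p) (hα : α ∈ Ioc 0 Real.pi) (hβ : β ∈ Ico 0 Real.pi)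
    (h : IsShootingFamily p α U V) {l : ℝ} (hl : IsLowestEigenvalue p α β l) :
    Iio l ⊆ {z : ℝ | ∀ x ∈ Ioc (0 : ℝ) 1, 0 < U z x} := by
  have hsin : 0 ≤ Real.sin α := Real.sin_nonneg_of_nonneg_of_le_pi hα.1.le hα.2
  have hcos : Real.sin α = 0 → 0 < -Real.cos α := fun h0 => by
    obtain rfl : α = Real.pi := by
      by_contra hne
      exact (Real.sin_pos_of_pos_of_lt_pi hα.1 (hα.2.lt_of_ne hne)).ne' h0
    simp
  obtain ⟨Λ, hΛ⟩ := h.exists_forall_le_pos_and_robin_right_pos hp hα hβ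
  refine isPreconnected_Iio.subset_of_closure_inter_subset (h.isOpen_setOf_pos hsin hcos)
    ⟨min Λ (l - 1), (min_le_right _ _).trans_lt (sub_one_lt l), (hΛ _ (min_le_left _ _)).1⟩ ?_
  rintro z ⟨hz, hzl⟩ x hx
  have hpos := h.pos_of_mem_closure hp.piecewiseContinuous (sin_ne_zero_or_neg_cos_ne_zero α) hz
  rcases hx.2.lt_or_eq with hx1 | rfl
  · exact hpos x ⟨hx.1, hx1⟩
  refine (h.nonneg_of_mem_closure hz 1 hx).lt_of_ne fun hU1 => ?_
  have hV1 : V z 1 ≤ 0 := (h.isRealSolution z).deriv_nonpos_of_pos_left hx hpos hU1.symm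
  refine (h.robin_right_pos_of_lt hp hα hβ hl hzl).not_ge ?_
  rw [robin, ← hU1, zero_mul, zero_add]
  exact mul_nonpos_of_nonpos_of_nonneg hV1 (Real.sin_nonneg_of_nonneg_of_le_pi hβ.1 hβ.2.le)

end IsShootingFamily

theorem IsLowestEigenvalue.exists_isPositiveEigenfunction {p : ℝ → ℝ} {α β l : ℝ}
    (hl : IsLowestEigenvalue p α β l) (hp : IsDensity p) (hα : α ∈ Ioc 0 Real.pi)
    (hβ : β ∈ Ico 0 Real.pi) : ∃ u v, IsPositiveEigenfunction p α β l u v := by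
  obtain ⟨U, V, h⟩ := hp.piecewiseContinuous.exists_isSolutionFamily (Real.sin α) (-Real.cos α)
  have hclosure : l ∈ closure {z : ℝ | ∀ x ∈ Ioc (0 : ℝ) 1, 0 < U z x} :=
    closure_mono (IsShootingFamily.pos_of_lt hp hα hβ h hl) (closure_Iio l ▸ self_mem_Iic)
  exact ⟨U l, V l, h.isRealSolution l, IsShootingFamily.robin_left h l,
    (IsShootingFamily.isEigenvalue_iff hp.piecewiseContinuous h).1 hl.1,
    h.pos_of_mem_closure hp.piecewiseContinuous (sin_ne_zero_or_neg_cos_ne_zero α) hclosure⟩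

theorem isRealSolution_affine (c d : ℝ) :
    IsRealSolution (fun _ => 0) (fun x => c + d * x) (fun _ => d) := by
  refine ⟨fun x _ => ?_, continuousOn_const, ∅, fun x _ _ => ?_⟩
  · exact ((((hasDerivAt_id x).const_mul d).const_add c).congr_deriv (mul_one d)).hasDerivWithinAt
  · exact (hasDerivAt_const x d).congr_deriv (by ring)

theorem IsRealSolution.eq_affine {u v : ℝ → ℝ} (h : IsRealSolution (fun _ => 0) u v) {x : ℝ}
    (hx : x ∈ Icc (0 : ℝ) 1) : v x = v 0 ∧ u x = u 0 + v 0 * x := by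
  have hone := h.wronskian_eq (isRealSolution_affine 1 0) hx
  have hid := h.wronskian_eq (isRealSolution_affine 0 1) hx
  unfold wronskian at hone hid
  have hv : v x = v 0 := by linear_combination -hone
  exact ⟨hv, by linear_combination hid + x * hv⟩

theorem pi_div_four_le_of_mul_add_mul_eq_zero {γ a d : ℝ} (hγ : 0 < γ) (ha : 0 ≤ a) (hd : 0 ≤ d)
    (had : 0 < a + d) (h : a * (Real.cos γ - Real.sin γ) + d * Real.sin γ = 0) :
    Real.pi / 4 ≤ γ := by
  by_contra! hlt
  have hsin : 0 < Real.sin γ :=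
    Real.sin_pos_of_pos_of_lt_pi hγ (by linarith [Real.pi_pos])
  have hcos : Real.sin γ < Real.cos γ := calc
    Real.sin γ < Real.sin (Real.pi / 4) :=
      Real.sin_lt_sin_of_lt_of_le_pi_div_two (by linarith) (by linarith [Real.pi_pos]) hlt
    _ = Real.cos (Real.pi / 4) := by rw [Real.sin_pi_div_four, Real.cos_pi_div_four]
    _ < Real.cos γ :=
      Real.cos_lt_cos_of_nonneg_of_le_pi hγ.le (by linarith [Real.pi_pos]) hlt
  rcases ha.eq_or_lt with rfl | ha
  · linarith [mul_pos (by simpa using had) hsin]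
  · linarith [mul_pos ha (sub_pos.2 hcos), mul_nonneg hd hsin.le]

namespace IsPositiveEigenfunction

variable {p q : ℝ → ℝ} {α β l m : ℝ} {u v w w' : ℝ → ℝ}

theorem nonneg (h : IsPositiveEigenfunction p α β l u v) {x : ℝ} (hx : x ∈ Icc (0 : ℝ) 1) :
    0 ≤ u x := by
  rw [← closure_Ioo zero_ne_one] at hx
  exact le_on_closure (fun y hy => (h.pos y hy).le) continuousOn_const
    (by simpa only [closure_Ioo zero_ne_one] using h.isRealSolution.continuousOn) hx

theorem mem_Icc_and_cos_mul_cos_sub_sin_sub_eq_zero (h : IsPositiveEigenfunction p α β 0 u v)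
    (hα : α ∈ Ioc 0 Real.pi) (hβ : β ∈ Ico 0 Real.pi) :
    (α ∈ Icc (Real.pi / 4) Real.pi ∧ β ∈ Icc 0 (3 * Real.pi / 4)) ∧
      Real.cos α * Real.cos β - Real.sin (α - β) = 0 := by
  have haff : ∀ {x}, x ∈ Icc (0 : ℝ) 1 → v x = v 0 ∧ u x = u 0 + v 0 * x :=
    IsRealSolution.eq_affine (by simpa only [zero_mul] using h.isRealSolution)
  obtain ⟨hv1, hu1⟩ := haff (right_mem_Icc.2 zero_le_one)
  have hu0 : 0 ≤ u 0 := h.nonneg (left_mem_Icc.2 zero_le_one)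
  have hu1_nonneg : 0 ≤ u 1 := h.nonneg (right_mem_Icc.2 zero_le_one)
  have hsum : 0 < u 0 + u 1 := by
    have hhalf := h.pos (1 / 2) (by norm_num)
    rw [(haff (by norm_num)).2] at hhalf
    linarith
  have hα_eq : u 0 * (Real.cos α - Real.sin α) + u 1 * Real.sin α = 0 := by
    have := h.robin_left
    unfold robin at this
    linear_combination this + Real.sin α * hu1
  have hβ_eq : u 1 * (Real.cos β + Real.sin β) - u 0 * Real.sin β = 0 := by
    have := h.robin_right
    unfold robin at this
    linear_combination this - Real.sin β * hv1 + Real.sin β * hu1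
  refine ⟨⟨⟨?_, hα.2⟩, hβ.1, ?_⟩, ?_⟩
  · exact pi_div_four_le_of_mul_add_mul_eq_zero hα.1 hu0 hu1_nonneg hsum hα_eq
  · have := pi_div_four_le_of_mul_add_mul_eq_zero (sub_pos.2 hβ.2) hu1_nonneg hu0
      (by rwa [add_comm]) (by rw [Real.cos_pi_sub, Real.sin_pi_sub]; linear_combination -hβ_eq)
    linarith
  · have h0 : u 0 * (Real.cos α * Real.cos β - Real.sin (α - β)) = 0 := by
      rw [Real.sin_sub]
      linear_combination (Real.cos β + Real.sin β) * hα_eq - Real.sin α * hβ_eq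
    have h1 : u 1 * (Real.cos α * Real.cos β - Real.sin (α - β)) = 0 := by
      rw [Real.sin_sub]
      linear_combination Real.sin β * hα_eq + (Real.cos α - Real.sin α) * hβ_eq
    exact (mul_eq_zero.1 (by linear_combination h0 + h1)).resolve_left hsum.ne'

theorem mul_eq_mul_off_finset (h : IsPositiveEigenfunction p α β l u v)
    (k : IsPositiveEigenfunction q α β m w w')
    (hqp : ∀ x ∈ Ioo (0 : ℝ) 1, m * q x ≤ l * p x) :
    ∃ F : Finset ℝ, ∀ x ∈ Ioo (0 : ℝ) 1, x ∉ F → l * p x = m * q x :=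
  h.isRealSolution.coeff_eq_off_finset k.isRealSolution h.pos k.pos
    (mul_sub_mul_eq_zero_of_robin_eq_zero h.robin_left k.robin_left)
    (mul_sub_mul_eq_zero_of_robin_eq_zero h.robin_right k.robin_right) hqp

end IsPositiveEigenfunction

theorem IsLowestEigenvalue.ne_zero {p : ℝ → ℝ} {α β l : ℝ} (hl : IsLowestEigenvalue p α β l)
    (hp : IsDensity p) (hα : α ∈ Ioc 0 Real.pi) (hβ : β ∈ Ico 0 Real.pi)
    (hcurve : α ∈ Icc (Real.pi / 4) Real.pi → β ∈ Icc 0 (3 * Real.pi / 4) →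
      Real.cos α * Real.cos β - Real.sin (α - β) ≠ 0) : l ≠ 0 := by
  rintro rfl
  obtain ⟨u, v, h⟩ := hl.exists_isPositiveEigenfunction hp hα hβ
  obtain ⟨⟨hα', hβ'⟩, hzero⟩ := h.mem_Icc_and_cos_mul_cos_sub_sin_sub_eq_zero hα hβ
  exact hcurve hα' hβ' hzero

namespace ContinuousFromCommonSide

variable {p q : ℝ → ℝ} {x : ℝ}

theorem const_mul (h : ContinuousFromCommonSide p q x) (a b : ℝ) :
    ContinuousFromCommonSide (fun y => a * p y) (fun y => b * q y) x :=
  h.imp (fun ⟨hx, hp, hq⟩ => ⟨hx, hp.const_mul a, hq.const_mul b⟩)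
    (fun ⟨hx, hp, hq⟩ => ⟨hx, hp.const_mul a, hq.const_mul b⟩)

theorem eq_of_eq_off_finset (h : ContinuousFromCommonSide p q x) (hx : x ∈ Icc (0 : ℝ) 1)
    {F : Finset ℝ} (hF : ∀ y ∈ Ioo (0 : ℝ) 1, y ∉ F → p y = q y) : p x = q x := by
  have hcofinite : 𝓝[≠] x ≤ cofinite := nhdsNE_le_cofinite x
  have hF_mem : (F : Set ℝ)ᶜ ∈ cofinite := F.finite_toSet.compl_mem_cofinite
  rcases h with ⟨hx1, hp, hq⟩ | ⟨hx0, hp, hq⟩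
  · have hle : 𝓝[>] x ≤ 𝓝[Icc x 1] x := nhdsWithin_le_of_mem (Icc_mem_nhdsGT hx1)
    refine tendsto_nhds_unique_of_eventuallyEq (hp.mono_left hle) (hq.mono_left hle) ?_
    filter_upwards [Ioo_mem_nhdsGT hx1, (nhdsGT_le_nhdsNE x).trans hcofinite hF_mem] with y hy hyF
    exact hF y ⟨hx.1.trans_lt hy.1, hy.2⟩ hyF
  · have hle : 𝓝[<] x ≤ 𝓝[Icc 0 x] x := nhdsWithin_le_of_mem (Icc_mem_nhdsLT hx0)
    refine tendsto_nhds_unique_of_eventuallyEq (hp.mono_left hle) (hq.mono_left hle) ?_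
    filter_upwards [Ioo_mem_nhdsLT hx0, (nhdsLT_le_nhdsNE x).trans hcofinite hF_mem] with y hy hyF
    exact hF y ⟨hy.1, hy.2.trans_le hx.2⟩ hyF

end ContinuousFromCommonSide

theorem mul_le_mul_or_of_isLUB_or_isGLB_div {X : Type*} {s : Set X} {p q : X → ℝ} {l m : ℝ}
    (hp : ∀ x ∈ s, 0 < p x)
    (h : (∃ M : ℝ, IsLUB ((fun x => q x / p x) '' s) M ∧ l = m * M) ∨
      (∃ M : ℝ, IsGLB ((fun x => q x / p x) '' s) M ∧ l = m * M)) :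
    (∀ x ∈ s, m * q x ≤ l * p x) ∨ (∀ x ∈ s, l * p x ≤ m * q x) := by
  rcases h with ⟨M, hM, rfl⟩ | ⟨M, hM, rfl⟩
  · have hle : ∀ x ∈ s, q x ≤ M * p x := fun x hx =>
      (div_le_iff₀ (hp x hx)).1 (hM.1 (mem_image_of_mem _ hx))
    simp only [mul_assoc]
    exact (le_total 0 m).imp (fun hm x hx => mul_le_mul_of_nonneg_left (hle x hx) hm)
      (fun hm x hx => mul_le_mul_of_nonpos_left (hle x hx) hm)
  · have hle : ∀ x ∈ s, M * p x ≤ q x := fun x hx =>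
      (le_div_iff₀ (hp x hx)).1 (hM.1 (mem_image_of_mem _ hx))
    simp only [mul_assoc]
    exact (le_total 0 m).symm.imp (fun hm x hx => mul_le_mul_of_nonpos_left (hle x hx) hm)
      (fun hm x hx => mul_le_mul_of_nonneg_left (hle x hx) hm)

theorem IsDensity.pos {p : ℝ → ℝ} (hp : IsDensity p) {x : ℝ} (hx : x ∈ Icc (0 : ℝ) 1) :
    0 < p x := by
  obtain ⟨c, hc, hpc⟩ := hp.boundedAway
  exact hc.trans_le (hpc x hx)

end VibratingString

theorem theorem2p1_general {p q : ℝ → ℝ} {α β l m : ℝ}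
    (hp : VibratingString.IsDensity p) (hq : VibratingString.IsDensity q)
    (hα : α ∈ Ioc 0 Real.pi) (hβ : β ∈ Ico 0 Real.pi)
    (hl : VibratingString.IsLowestEigenvalue p α β l)
    (hm : VibratingString.IsLowestEigenvalue q α β m)
    (h : (∀ x ∈ Ioo (0 : ℝ) 1, m * q x ≤ l * p x) ∨ (∀ x ∈ Ioo (0 : ℝ) 1, l * p x ≤ m * q x)) :
    {x ∈ Icc (0 : ℝ) 1 | l * p x ≠ m * q x}.Finite ∧
    ∀ x ∈ Icc (0 : ℝ) 1, VibratingString.ContinuousFromCommonSide p q x → l * p x = m * q x := by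
  obtain ⟨u, v, hu⟩ := hl.exists_isPositiveEigenfunction hp hα hβ
  obtain ⟨w, w', hw⟩ := hm.exists_isPositiveEigenfunction hq hα hβ
  obtain ⟨F, hF⟩ : ∃ F : Finset ℝ, ∀ x ∈ Ioo (0 : ℝ) 1, x ∉ F → l * p x = m * q x := by
    rcases h with hqp | hpq
    · exact hu.mul_eq_mul_off_finset hw hqp
    · exact (hw.mul_eq_mul_off_finset hu hpq).imp fun F hF x hx hxF => (hF x hx hxF).symm
  refine ⟨(F.finite_toSet.union (toFinite {0, 1})).subset fun x ⟨hx, hne⟩ => ?_,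
    fun x hx hside => (hside.const_mul l m).eq_of_eq_off_finset hx hF⟩
  by_contra! hxF
  simp only [mem_union, mem_insert_iff, mem_singleton_iff, not_or, SetLike.mem_coe] at hxF
  obtain ⟨hxF, hx0, hx1⟩ := hxF
  exact hne (hF x ⟨hx.1.lt_of_ne' hx0, hx.2.lt_of_ne hx1⟩ hxF)

theorem theorem2p1 (p q : ℝ → ℝ) (α β l m : ℝ)
    (hp : VibratingString.IsDensity p) (hq : VibratingString.IsDensity q)
    (hα : α ∈ Set.Ioc 0 Real.pi) (hβ : β ∈ Set.Ico 0 Real.pi)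
    (hcurve : α ∈ Set.Icc (Real.pi / 4) Real.pi → β ∈ Set.Icc 0 (3 * Real.pi / 4) →
      Real.cos α * Real.cos β - Real.sin (α - β) ≠ 0)
    (hl : VibratingString.IsLowestEigenvalue p α β l)
    (hm : VibratingString.IsLowestEigenvalue q α β m)
    (h : (∃ M : ℝ, IsLUB ((fun x => q x / p x) '' Set.Icc 0 1) M ∧ l = m * M) ∨
      (∃ M : ℝ, IsGLB ((fun x => q x / p x) '' Set.Icc 0 1) M ∧ l = m * M)) :
    {x ∈ Set.Icc (0 : ℝ) 1 | p x ≠ m / l * q x}.Finite ∧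
    ∀ x ∈ Set.Icc (0 : ℝ) 1, VibratingString.ContinuousFromCommonSide p q x →
      p x = m / l * q x := by
  have hl0 : l ≠ 0 := hl.ne_zero hp hα hβ hcurve
  have heq : ∀ x, p x = m / l * q x ↔ l * p x = m * q x := fun x => by
    rw [div_mul_eq_mul_div, eq_div_iff hl0, mul_comm]
  have hord := VibratingString.mul_le_mul_or_of_isLUB_or_isGLB_div (fun _ => hp.pos) h
  simpa only [ne_eq, heq] using theorem2p1_general hp hq hα hβ hl hm <|
    hord.imp (fun h x hx => h x (Ioo_subset_Icc_self hx)) fun h x hx => h x (Ioo_subset_Icc_self hx)
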